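/- Let $f:\mathbb{R}^d\times\mathcal{Z}\to\mathbb{R}$ be a loss such that for every $z\in\mathcal{Z}$ the function $f(\cdot;z)$ is differentiable, $L$-smooth ($\|\nabla f(x;z)-\nabla f(y;z)\|\le L\|x-y\|$ for all $x,y$, with $L\ge 0$) and $G$-Lipschitz ($\|\nabla f(x;z)\|\le G$ for all $x$). Let $\psi:\mathbb{R}^d\to(-\infty,+\infty]$ be a proper, lower semicontinuous, convex regularizer, let $\sigma>0$, and let $0<\eta\le 1/L$ (any $\eta>0$ if $L=0$). The private shuffled gradient method DP-ShuffleG takes a dataset $D=(d_1,\dots,d_n)\in\mathcal{Z}^n$, starts at a fixed point $x_1^{(1)}\in\mathbb{R}^d$ and runs for $K$ epochs. In epoch $s=1,\dots,K$, with a permutation $\pi^{(s)}$ of $\{1,\dots,n\}$, it computes $$x_{i+1}^{(s)}=x_i^{(s)}-\eta\left(\nabla f(x_i^{(s)};d_{\pi_i^{(s)}})+\rho_i^{(s)}\right),\qquad i=1,\dots,n,$$ with independent $\rho_i^{(s)}\sim\mathcal{N}(0,\sigma^2 I_d)$, and then sets $$x_1^{(s+1)}=\operatorname*{argmin}_{x\in\mathbb{R}^d}\;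 n\,\psi(x)+\frac{\|x-x_{n+1}^{(s)}\|^2}{2\eta}.$$ Only $x_1^{(K+1)}$ is released. The orders $\pi^{(s)}$, independent of the noise, are either one prescribed permutation in all epochs (incremental gradient), or one uniformly random permutation used in all epochs (shuffle once), or independent uniformly random permutations (random reshuffling). Then, for each of the three ordering rules, for every $\alpha>1$ and $\delta\in(0,1)$, DP-ShuffleG is $$\left(\frac{2\alpha G^2K}{\sigma^2}+\frac{\log(1/\delta)}{\alpha-1},\ \delta\right)\text{-differentially private:}$$ writing $\varepsilon$ for the first entry, $\Pr[x_1^{(K+1)}(D)\in S]\le e^{\varepsilon}\Pr[x_1^{(K+1)}(D')\in S]+\delta$ for all $D,D'\in\mathcal{Z}^n$ that differ in at most one index and all measurable $S\subseteq\mathbb{R}^d$. -/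

import Mathlib

open MeasureTheory ProbabilityTheory

/-- The parameter space `ℝ^d` with the Euclidean norm. -/
abbrev Param (d : ℕ) : Type := EuclideanSpace ℝ (Fin d)

/-- `h` is `L`-smooth: it is differentiable and its gradient is `L`-Lipschitz. -/
def IsSmoothLoss {d : ℕ} (L : ℝ) (h : Param d → ℝ) : Prop :=
  Differentiable ℝ h ∧ ∀ x y, ‖gradient h x - gradient h y‖ ≤ L * ‖x - y‖

/-- `h` is `G`-Lipschitz: it is differentiable and its gradient has norm at most `G`. -/
def IsLipschitzLoss {d : ℕ} (G : ℝ) (h : Param d → ℝ) : Prop :=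
  Differentiable ℝ h ∧ ∀ x, ‖gradient h x‖ ≤ G

/-- Convex regularizers, with values in `(-∞, +∞]`: proper, convex (the epigraph is a convex set)
and lower semicontinuous. Finite convex functions, norms, and indicator functions of nonempty closed
convex sets are of this kind. -/
structure IsConvexRegularizer {d : ℕ} (ψ : Param d → EReal) : Prop where
  ne_bot : ∀ x, ψ x ≠ ⊥
  proper : ∃ x, ψ x ≠ ⊤
  convex_epigraph : Convex ℝ {p : Param d × ℝ | ψ p.1 ≤ (p.2 : EReal)}
  lsc : LowerSemicontinuous ψ

/-- The objective `x ↦ n ψ(x) + ‖x - z‖² / (2η)` of the regularization step. -/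
noncomputable def proxObjective {d : ℕ} (n : ℕ) (ψ : Param d → EReal) (η : ℝ) (z x : Param d) :
    EReal :=
  (n : EReal) * ψ x + ((‖x - z‖ ^ 2 / (2 * η) : ℝ) : EReal)

/-- The regularization step: `argmin_x n ψ(x) + ‖x - z‖² / (2η)`. For a convex regularizer and
`η > 0` there is exactly one minimizer. -/
noncomputable def proxStep {d : ℕ} (n : ℕ) (ψ : Param d → EReal) (η : ℝ) (z : Param d) : Param d :=
  Classical.epsilon fun x => IsMinOn (proxObjective n ψ η z) Set.univ x

/-- The noise distribution `N(0, σ² I_d)`. -/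
noncomputable def noiseLaw (d : ℕ) (σ : ℝ) : Measure (Param d) :=
  multivariateGaussian 0 (σ ^ 2 • (1 : Matrix (Fin d) (Fin d) ℝ))

/-- One noisy gradient step on the loss `h`, at the level of laws: if `x ∼ μ` and
`ρ ∼ N(0, σ² I_d)` are independent, this is the law of `x - η (∇h(x) + ρ)`. -/
noncomputable def noisyGradLaw {d : ℕ} (η σ : ℝ) (h : Param d → ℝ) (μ : Measure (Param d)) :
    Measure (Param d) :=
  (μ.prod (noiseLaw d σ)).map fun p => p.1 - η • (gradient h p.1 + p.2)

/-- One epoch on the dataset `D`, processed in the order `D (π 0), …, D (π (n - 1))`: the law of the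
iterate after `n` noisy gradient steps and the final regularization step, when the epoch starts
from an iterate with law `μ`. -/
noncomputable def epochLaw {d n : ℕ} {Z : Type*} (f : Param d → Z → ℝ) (ψ : Param d → EReal)
    (η σ : ℝ) (D : Fin n → Z) (π : Equiv.Perm (Fin n)) (μ : Measure (Param d)) :
    Measure (Param d) :=
  ((List.finRange n).foldl (fun ν i => noisyGradLaw η σ (fun x => f x (D (π i))) ν) μ).map
    (proxStep n ψ η)

/-- The law of the last iterate after `K` epochs started at `x₀`, epoch `s` using the order `π s`. -/
noncomputable def runLaw {d n : ℕ} {Z : Type*} (f : Param d → Z → ℝ) (ψ : Param d → EReal)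
    (η σ : ℝ) (x₀ : Param d) (K : ℕ) (D : Fin n → Z) (π : Fin K → Equiv.Perm (Fin n)) :
    Measure (Param d) :=
  (List.finRange K).foldl (fun μ s => epochLaw f ψ η σ D (π s) μ) (Measure.dirac x₀)

/-- The three ways of ordering the samples: incremental gradient (a prescribed order in all epochs),
shuffle once (one uniformly random order in all epochs), random reshuffling (an independent uniformly
random order in each epoch). -/
inductive ShuffleScheme (n : ℕ) : Type
  | incrementalGradient (π : Equiv.Perm (Fin n))
  | shuffleOnce
  | randomReshuffling

/-- The distribution of the orders used in the `K` epochs. -/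
noncomputable def ShuffleScheme.orderLaw {n : ℕ} (K : ℕ) :
    ShuffleScheme n → PMF (Fin K → Equiv.Perm (Fin n))
  | .incrementalGradient π => PMF.pure fun _ => π
  | .shuffleOnce => (PMF.uniformOfFintype (Equiv.Perm (Fin n))).map fun π _ => π
  | .randomReshuffling => PMF.uniformOfFintype (Fin K → Equiv.Perm (Fin n))

/-- The private shuffled gradient method, as a map from datasets to the law of the released point,
which is the last iterate; the random orders are independent of the noise. -/
noncomputable def dpShuffleG {d n : ℕ} {Z : Type*} (scheme : ShuffleScheme n)
    (f : Param d → Z → ℝ) (ψ : Param d → EReal) (η σ : ℝ) (x₀ : Param d) (K : ℕ)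
    (D : Fin n → Z) : Measure (Param d) :=
  ∑ π : Fin K → Equiv.Perm (Fin n), scheme.orderLaw K π • runLaw f ψ η σ x₀ K D π

/-- Two datasets of the same size are adjacent if they agree except possibly at one index. -/
def AdjacentDatasets {n : ℕ} {Z : Type*} (D D' : Fin n → Z) : Prop :=
  ∃ t, ∀ i, i ≠ t → D i = D' i

/-- `M` is a randomized mechanism (each `M D` is a probability measure) that satisfies
`(ε, δ)`-differential privacy. -/
structure IsDifferentiallyPrivate {n : ℕ} {Z R : Type*} [MeasurableSpace R]
    (M : (Fin n → Z) → Measure R) (ε δ : ℝ) : Prop where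
  isProbability : ∀ D, IsProbabilityMeasure (M D)
  privacy : ∀ D D', AdjacentDatasets D D' → ∀ S, MeasurableSet S →
    M D S ≤ ENNReal.ofReal (Real.exp ε) * M D' S + ENNReal.ofReal δ

/-!
The privacy loss is measured by Rényi divergence of order `α`, in the dual form `MomentDominated`:
for probability measures and finite `A`, `μ` has a density with respect to `ν` whose norm in
`L^α(ν)` is at most `A` if and only if `∫ g dμ ≤ A (∫ g^q dν)^(1/q)` for all measurable `g ≥ 0`,
where `q` is conjugate to `α`. In this form the constant does not change under a
common measurable map (`MomentDominated.map`) or a common mixture (`MomentDominated.sum`), and constants multiply under adaptive composition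
(`MomentDominated.lintegral_le`).

For a translate by `a` of `N(0, σ² I)` the constant is `exp ((α - 1) ‖a‖² / (2 σ²))`: in dimension
one by Hölder's inequality applied to the likelihood ratio, then coordinatewise
(`MomentDominated.noiseLaw_shift`). Fix the orders. In each epoch exactly one gradient step uses the
datum at which the two datasets differ, and there the two steps differ by a translation of the noise
of norm at most `2 G`; all other operations are the same on both sides. So an epoch costs a factor
`exp (2 (α - 1) G² / σ²)`, and `K` epochs cost the `K`-th power of it (`MomentDominated.runLaw`),
a Rényi divergence of at most `2 α G² K / σ²`. Averaging over the orders keeps this bound, and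
`MomentDominated.measure_le` turns it into differential privacy.

The regularization step enters only as a measurable map. It is even nonexpansive
(`lipschitzWith_proxStep`), because the objective has a minimizer and the optimality conditions of
two minimizers can be added.
-/

open scoped ENNReal

/-! ### Domination in the sense of Rényi divergence -/

/-- Domination of `μ` by `ν` in the sense of Rényi divergence, written by duality: if `α` is the
exponent conjugate to `q`, then `MomentDominated q A μ ν` says that the density `dμ/dν` has norm at
most `A` in `L^α(ν)`, that is, `D_α(μ‖ν) ≤ α / (α - 1) * log A`. Testing against nonnegative
functions avoids densities altogether and makes every closure property below a short computation
with Lebesgue integrals. -/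
def MomentDominated {X : Type*} [MeasurableSpace X] (q : ℝ) (A : ℝ≥0∞) (μ ν : Measure X) : Prop :=
  ∀ g : X → ℝ≥0∞, Measurable g → ∫⁻ x, g x ∂μ ≤ A * (∫⁻ x, g x ^ q ∂ν) ^ (1 / q)

namespace MomentDominated

variable {X Y : Type*} [MeasurableSpace X] [MeasurableSpace Y] {q : ℝ} {A B : ℝ≥0∞}

lemma mono {μ ν : Measure X} (h : MomentDominated q A μ ν) (hAB : A ≤ B) :
    MomentDominated q B μ ν := fun g hg => (h g hg).trans (by gcongr)

protected lemma refl (hq : 1 < q) (μ : Measure X) [IsProbabilityMeasure μ] :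
    MomentDominated q 1 μ μ := by
  intro g hg
  have := ENNReal.lintegral_mul_le_Lp_mul_Lq μ (Real.HolderConjugate.conjExponent hq).symm
    (aemeasurable_const (b := (1 : ℝ≥0∞))) hg.aemeasurable
  simpa using this

lemma map {μ ν : Measure X} (h : MomentDominated q A μ ν) {φ : X → Y} (hφ : Measurable φ) :
    MomentDominated q A (μ.map φ) (ν.map φ) := by
  intro g hg
  rw [lintegral_map hg hφ, lintegral_map (hg.pow_const q) hφ]
  exact h _ (hg.comp hφ)

/-- Adaptive composition. With `u x = ∫ g dκ_x` and `v x = ∫ g^q dκ'_x` for two families of measures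
such that each `κ_x` is dominated by `κ'_x` with constant `B`, this bounds the integral of `g`
against the composition of `μ` with `κ`, and shows that constants multiply. -/
lemma lintegral_le (hq : 0 < q) {μ ν : Measure X} (h : MomentDominated q A μ ν)
    {u v : X → ℝ≥0∞} (hv : Measurable v) (huv : ∀ x, u x ≤ B * v x ^ (1 / q)) :
    ∫⁻ x, u x ∂μ ≤ A * B * (∫⁻ x, v x ∂ν) ^ (1 / q) := by
  calc ∫⁻ x, u x ∂μ ≤ ∫⁻ x, B * v x ^ (1 / q) ∂μ := lintegral_mono huv
    _ = B * ∫⁻ x, v x ^ (1 / q) ∂μ := lintegral_const_mul _ (hv.pow_const _)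
    _ ≤ B * (A * (∫⁻ x, (v x ^ (1 / q)) ^ q ∂ν) ^ (1 / q)) := by
        gcongr; exact h _ (hv.pow_const _)
    _ = _ := by
        simp only [← ENNReal.rpow_mul, one_div, inv_mul_cancel₀ hq.ne', ENNReal.rpow_one]
        ring

lemma prod (hq : 0 < q) {μ ν : Measure X} {μ' ν' : Measure Y} [SFinite μ'] [SFinite ν']
    (h : MomentDominated q A μ ν) (h' : MomentDominated q B μ' ν') :
    MomentDominated q (A * B) (μ.prod μ') (ν.prod ν') := by
  intro g hg
  rw [lintegral_prod _ hg.aemeasurable, lintegral_prod _ (hg.pow_const q).aemeasurable]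
  exact h.lintegral_le hq (hg.pow_const q).lintegral_prod_right'
    fun x => h' _ (hg.comp measurable_prodMk_left)

/-- Constants multiply over independent coordinates. -/
lemma pi (hq : 1 < q) {n : ℕ} {μ ν : Fin n → Measure ℝ} [∀ i, IsProbabilityMeasure (μ i)]
    [∀ i, IsProbabilityMeasure (ν i)] {C : Fin n → ℝ≥0∞}
    (h : ∀ i, MomentDominated q (C i) (μ i) (ν i)) :
    MomentDominated q (∏ i, C i) (Measure.pi μ) (Measure.pi ν) := by
  induction n with
  | zero =>
    rw [Subsingleton.elim μ ν]
    simpa using MomentDominated.refl hq (Measure.pi ν)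
  | succ n ih =>
    have key := ((h 0).prod (zero_lt_one.trans hq) (ih fun i => h i.succ)).map
      (MeasurableEquiv.piFinSuccAbove (fun _ => ℝ) (0 : Fin (n + 1))).symm.measurable
    have e1 := (measurePreserving_piFinSuccAbove μ 0).symm.map_eq
    have e2 := (measurePreserving_piFinSuccAbove ν 0).symm.map_eq
    simp only [Fin.zero_succAbove] at e1 e2
    rw [e1, e2] at key
    rwa [Fin.prod_univ_succ]

/-- Mixing with the same weights on both sides does not increase the constant, by Jensen's
inequality for `t ↦ t ^ q`. -/
lemma sum {ι : Type*} [Fintype ι] (hq : 1 < q) {w : ι → ℝ≥0∞} (hw : ∑ i, w i = 1)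
    {μ ν : ι → Measure X} (h : ∀ i, MomentDominated q A (μ i) (ν i)) :
    MomentDominated q A (∑ i, w i • μ i) (∑ i, w i • ν i) := by
  intro g hg
  have hq0 : 0 < q := zero_lt_one.trans hq
  simp only [lintegral_finsetSum_measure, lintegral_smul_measure, smul_eq_mul]
  calc ∑ i, w i * ∫⁻ x, g x ∂μ i
      ≤ ∑ i, w i * (A * (∫⁻ x, g x ^ q ∂ν i) ^ (1 / q)) := by
        gcongr with i; exact h i g hg
    _ = A * ∑ i, w i * (∫⁻ x, g x ^ q ∂ν i) ^ (1 / q) := by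
        rw [Finset.mul_sum]; exact Finset.sum_congr rfl fun i _ => by ring
    _ ≤ _ := by
        gcongr
        rw [one_div, ENNReal.le_rpow_inv_iff hq0, ← one_div]
        refine (ENNReal.rpow_arith_mean_le_arith_mean_rpow _ _ _ hw hq.le).trans ?_
        simp only [← ENNReal.rpow_mul, one_div, inv_mul_cancel₀ hq0.ne', ENNReal.rpow_one]
        exact le_rfl

/-- From Rényi divergence at most `r` to approximate differential privacy: testing with an indicator
gives `μ S ≤ (e ^ r * ν S) ^ ((α - 1) / α)`, and this is either at most `δ`, or at most
`e ^ r * ν S * δ ^ (-1 / (α - 1))`. -/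
lemma measure_le {α ε : ℝ} (hα : 1 < α) (hq : α.HolderConjugate q) {r δ : ℝ} (hδ : 0 < δ)
    {μ ν : Measure X} [IsProbabilityMeasure ν]
    (h : MomentDominated q (ENNReal.ofReal (Real.exp ((α - 1) / α * r))) μ ν)
    (hε : ε = r + Real.log (1 / δ) / (α - 1)) {S : Set X} (hS : MeasurableSet S) :
    μ S ≤ ENNReal.ofReal (Real.exp ε) * ν S + ENNReal.ofReal δ := by
  have hα0 : 0 < α := by linarith
  have hα1 : 0 < α - 1 := by linarith
  have hqinv : 1 / q = (α - 1) / α := by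
    rw [one_div, ← hq.one_sub_inv]; field_simp
  have hν : ν S = ENNReal.ofReal (ν S).toReal := (ENNReal.ofReal_toReal (measure_ne_top _ _)).symm
  have h0 : (0 : ℝ) ≤ (ν S).toReal := ENNReal.toReal_nonneg
  generalize (ν S).toReal = t at hν h0
  have h1 := h (S.indicator 1) (measurable_one.indicator hS)
  have h2 : (fun x => (S.indicator (1 : X → ℝ≥0∞) x) ^ q) = S.indicator 1 := by
    ext x
    by_cases hx : x ∈ S <;> simp [hx, hq.symm.pos]
  rw [h2, lintegral_indicator_one hS, lintegral_indicator_one hS, hν, hqinv,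
    ENNReal.ofReal_rpow_of_nonneg h0 (by positivity), ← ENNReal.ofReal_mul (by positivity)] at h1
  refine h1.trans ?_
  rw [hν, ← ENNReal.ofReal_mul (by positivity), ← ENNReal.ofReal_add (by positivity) hδ.le]
  apply ENNReal.ofReal_le_ofReal
  rcases h0.eq_or_lt with rfl | ht
  · rw [Real.zero_rpow (by positivity)]; simp [hδ.le]
  -- In logarithmic coordinates the case distinction becomes linear arithmetic.
  obtain ⟨s, rfl⟩ : ∃ s, t = Real.exp s := ⟨_, (Real.exp_log ht).symm⟩
  obtain ⟨l, rfl⟩ : ∃ l, δ = Real.exp l := ⟨_, (Real.exp_log hδ).symm⟩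
  rw [← Real.exp_mul, ← Real.exp_add, ← Real.exp_add]
  rw [one_div, Real.log_inv, Real.log_exp] at hε
  rcases le_total ((α - 1) / α * r + s * ((α - 1) / α)) l with hl | hl
  · have := Real.exp_le_exp.2 hl
    have := Real.exp_pos (ε + s)
    linarith
  · have : (α - 1) / α * r + s * ((α - 1) / α) ≤ ε + s := by
      have e : (α - 1) / α * r + s * ((α - 1) / α) = (r + s) - (r + s) / α := by
        field_simp
      have e2 : l / (α - 1) ≤ (r + s) / α := by
        rw [div_le_div_iff₀ hα1 hα0]
        have : (α - 1) / α * r + s * ((α - 1) / α) = (r + s) * (α - 1) / α := by ring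
        rw [this, le_div_iff₀ hα0] at hl
        exact hl
      rw [e, hε, neg_div]
      linarith
    have := Real.exp_le_exp.2 this
    have := Real.exp_pos l
    linarith

/-! ### Translates of Gaussian measures -/

/-- Hölder's inequality for the likelihood ratio `exp (a x - a² / 2)`, whose `α`-th moment is
`exp (α (α - 1) a² / 2)`. -/
lemma gaussianReal_shift {α : ℝ} (hq : α.HolderConjugate q) (a : ℝ) :
    MomentDominated q (ENNReal.ofReal (Real.exp ((α - 1) * a ^ 2 / 2)))
      (gaussianReal a 1) (gaussianReal 0 1) := by
  intro g hg
  -- The likelihood ratio of the two Gaussian laws.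
  let R : ℝ → ℝ≥0∞ := fun x => ENNReal.ofReal (Real.exp (a * x - a ^ 2 / 2))
  have hR : Measurable R := by fun_prop
  have hpdf : ∀ x, gaussianPDF a 1 x = gaussianPDF 0 1 x * R x := by
    intro x
    simp only [gaussianPDF, R]
    rw [← ENNReal.ofReal_mul (gaussianPDFReal_nonneg _ _ _), gaussianPDFReal, gaussianPDFReal,
      mul_assoc _ (Real.exp _), ← Real.exp_add]
    congr 3
    simp only [NNReal.coe_one]
    ring
  have e1 : ∫⁻ x, g x ∂(gaussianReal a 1)
      = ∫⁻ x, (R * g) x ∂(gaussianReal 0 1) := by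
    rw [gaussianReal_of_var_ne_zero _ one_ne_zero, gaussianReal_of_var_ne_zero _ one_ne_zero,
      lintegral_withDensity_eq_lintegral_mul _ (measurable_gaussianPDF _ _) hg,
      lintegral_withDensity_eq_lintegral_mul _ (measurable_gaussianPDF _ _) (hR.mul hg)]
    exact lintegral_congr fun x => by simp only [Pi.mul_apply, hpdf, mul_assoc]
  have e2 : ∫⁻ x, R x ^ α ∂(gaussianReal 0 1)
      = ENNReal.ofReal (Real.exp (α * (α - 1) * a ^ 2 / 2)) := by
    have : ∀ x, R x ^ α = ENNReal.ofReal (Real.exp (-(α * a ^ 2 / 2)) * Real.exp (α * a * x)) := by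
      intro x
      rw [ENNReal.ofReal_rpow_of_nonneg (Real.exp_pos _).le hq.nonneg, ← Real.exp_mul,
        ← Real.exp_add]
      congr 2
      ring
    simp only [this]
    rw [← ofReal_integral_eq_lintegral_ofReal ((integrable_exp_mul_gaussianReal _).const_mul _)
      (.of_forall fun x => by positivity), integral_const_mul]
    have := congrFun (mgf_id_gaussianReal (μ := 0) (v := 1)) (α * a)
    simp only [mgf, id] at this
    rw [this, ← Real.exp_add]
    congr 2
    simp only [NNReal.coe_one]
    ring
  rw [e1]
  refine (ENNReal.lintegral_mul_le_Lp_mul_Lq _ hq hR.aemeasurable hg.aemeasurable).trans ?_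
  gcongr
  rw [e2, ENNReal.ofReal_rpow_of_nonneg (Real.exp_pos _).le (by have := hq.pos; positivity),
    ← Real.exp_mul]
  apply le_of_eq
  congr 2
  have := hq.pos.ne'
  field_simp

lemma stdGaussian_shift {α : ℝ} (hq : α.HolderConjugate q) {d : ℕ} (a : Param d) :
    MomentDominated q (ENNReal.ofReal (Real.exp ((α - 1) * ‖a‖ ^ 2 / 2)))
      ((stdGaussian (Param d)).map (· + a)) (stdGaussian (Param d)) := by
  have h := (MomentDominated.pi hq.symm.lt fun i : Fin d => gaussianReal_shift hq (a i)).map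
    (WithLp.measurable_toLp 2 (Fin d → ℝ))
  rw [map_pi_eq_stdGaussian] at h
  have e : (stdGaussian (Param d)).map (· + a) =
      (Measure.pi fun i : Fin d => gaussianReal (a i) 1).map (WithLp.toLp 2) := by
    rw [← map_pi_eq_stdGaussian, Measure.map_map (by fun_prop) (by fun_prop)]
    have : ∀ i : Fin d, gaussianReal (a i) 1
        = (gaussianReal 0 1).map (· + a i) := fun i => by
      rw [gaussianReal_map_add_const, zero_add]
    simp only [this]
    rw [← Measure.pi_map_pi (fun i => by fun_prop),
      Measure.map_map (by fun_prop) (by fun_prop)]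
    rfl
  rw [e]
  convert h using 1
  rw [← ENNReal.ofReal_prod_of_nonneg fun _ _ => (Real.exp_pos _).le, ← Real.exp_sum,
    EuclideanSpace.real_norm_sq_eq, Finset.mul_sum, Finset.sum_div]

end MomentDominated

lemma noiseLaw_eq_map_stdGaussian {d : ℕ} (σ : ℝ) :
    noiseLaw d σ = (stdGaussian (Param d)).map (σ • ·) := by
  have hS : (σ ^ 2 • (1 : Matrix (Fin d) (Fin d) ℝ)).PosSemidef :=
    Matrix.PosSemidef.one.smul (sq_nonneg σ)
  have : IsFiniteMeasure (noiseLaw d σ) := by unfold noiseLaw; infer_instance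
  apply Measure.ext_of_charFun
  ext t
  rw [noiseLaw, charFun_multivariateGaussian hS, charFun_map_smul, charFun_stdGaussian]
  congr 1
  have : t.ofLp ⬝ᵥ (σ ^ 2 • (1 : Matrix (Fin d) (Fin d) ℝ)).mulVec t.ofLp = σ ^ 2 * ‖t‖ ^ 2 := by
    rw [Matrix.smul_mulVec, Matrix.one_mulVec, dotProduct_smul, EuclideanSpace.real_norm_sq_eq]
    simp [dotProduct, sq]
  rw [this, norm_smul, ← Complex.ofReal_pow, mul_pow, Real.norm_eq_abs, sq_abs]
  push_cast
  simp only [inner_zero_right, Complex.ofReal_zero, zero_mul, zero_sub]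
  ring

instance isProbabilityMeasure_noiseLaw {d : ℕ} (σ : ℝ) : IsProbabilityMeasure (noiseLaw d σ) := by
  unfold noiseLaw; infer_instance

lemma MomentDominated.noiseLaw_shift {α q : ℝ} (hq : α.HolderConjugate q) {d : ℕ} {σ : ℝ}
    (hσ : 0 < σ) (a : Param d) :
    MomentDominated q (ENNReal.ofReal (Real.exp ((α - 1) * ‖a‖ ^ 2 / (2 * σ ^ 2))))
      ((noiseLaw d σ).map (· + a)) (noiseLaw d σ) := by
  have h := (MomentDominated.stdGaussian_shift hq (σ⁻¹ • a)).map
    (measurable_const_smul (α := Param d) σ)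
  rw [← noiseLaw_eq_map_stdGaussian] at h
  have e : (noiseLaw d σ).map (· + a)
      = ((stdGaussian (Param d)).map (· + σ⁻¹ • a)).map (σ • ·) := by
    rw [noiseLaw_eq_map_stdGaussian, Measure.map_map (by fun_prop) (by fun_prop),
      Measure.map_map (by fun_prop) (by fun_prop)]
    congr 1
    ext1 x
    simp [smul_smul, hσ.ne']
  have hnorm : (α - 1) * ‖a‖ ^ 2 / (2 * σ ^ 2) = (α - 1) * ‖σ⁻¹ • a‖ ^ 2 / 2 := by
    rw [norm_smul, norm_inv, Real.norm_of_nonneg hσ.le]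
    field_simp
  rw [e, hnorm]
  exact h

/-! ### The regularization step is nonexpansive -/

namespace IsConvexRegularizer

variable {d : ℕ} {φ : Param d → EReal}

lemma convexCombo_le (hφ : IsConvexRegularizer φ) {x y : Param d} {a b t : ℝ} (hx : φ x ≤ a)
    (hy : φ y ≤ b) (ht₀ : 0 ≤ t) (ht₁ : t ≤ 1) :
    φ (x + t • (y - x)) ≤ ((a + t * (b - a) : ℝ) : EReal) := by
  have h := hφ.convex_epigraph (x := (x, a)) hx (y := (y, b)) hy (sub_nonneg.2 ht₁) ht₀ (by ring)
  simp only [Set.mem_ofPred_eq, Prod.smul_mk, Prod.mk_add_mk, smul_eq_mul] at h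
  rwa [show x + t • (y - x) = (1 - t) • x + t • y by module,
    show a + t * (b - a) = (1 - t) * a + t * b by ring]

/-- Absorbs the factor `n` of the regularization step. For `n = 0` the product is the zero function,
since `0 * ⊤ = 0` in `EReal`. -/
lemma nat_mul {ψ : Param d → EReal} (hψ : IsConvexRegularizer ψ) (n : ℕ) :
    IsConvexRegularizer fun x => (n : EReal) * ψ x := by
  rcases n.eq_zero_or_pos with rfl | hn
  · refine ⟨by simp, ⟨0, by simp⟩, ?_, ?_⟩
    · simp only [Nat.cast_zero, zero_mul]
      have : {p : Param d × ℝ | (0 : EReal) ≤ (p.2 : EReal)} = Prod.snd ⁻¹' Set.Ici (0 : ℝ) := by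
        ext p; simp
      rw [this]
      exact (convex_Ici 0).linear_preimage (LinearMap.snd ℝ (Param d) ℝ)
    · simp only [Nat.cast_zero, zero_mul]
      exact lowerSemicontinuous_const
  have hn' : (0 : ℝ) < n := by exact_mod_cast hn
  have hcast : (n : EReal) = ((n : ℝ) : EReal) := by simp
  simp only [hcast]
  have hle : ∀ x (r : ℝ), ((n : ℝ) : EReal) * ψ x ≤ r ↔ ψ x ≤ ((r / n : ℝ) : EReal) := by
    intro x r
    induction h : ψ x with
    | bot => exact absurd h (hψ.ne_bot x)
    | top => rw [EReal.coe_mul_top_of_pos hn']; simp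
    | coe a =>
      rw [← EReal.coe_mul, EReal.coe_le_coe_iff, EReal.coe_le_coe_iff, le_div_iff₀ hn', mul_comm]
  refine ⟨fun x => ?_, ?_, ?_, ?_⟩
  · induction h : ψ x with
    | bot => exact absurd h (hψ.ne_bot x)
    | top => rw [EReal.coe_mul_top_of_pos hn']; simp
    | coe a => rw [← EReal.coe_mul]; exact EReal.coe_ne_bot _
  · obtain ⟨x, hx⟩ := hψ.proper
    refine ⟨x, ?_⟩
    induction h : ψ x with
    | bot => exact absurd h (hψ.ne_bot x)
    | top => exact absurd h hx
    | coe a => rw [← EReal.coe_mul]; exact EReal.coe_ne_top _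
  · simp only [hle]
    have := hψ.convex_epigraph.linear_preimage
      (LinearMap.prodMap LinearMap.id ((n : ℝ)⁻¹ • LinearMap.id) : Param d × ℝ →ₗ[ℝ] Param d × ℝ)
    simpa only [Set.preimage, Set.mem_ofPred_eq, LinearMap.prodMap_apply, LinearMap.id_apply,
      LinearMap.smul_apply, smul_eq_mul, ← div_eq_inv_mul] using this
  · refine Continuous.comp_lowerSemicontinuous (g := fun y => ((n : ℝ) : EReal) * y) ?_ hψ.lsc ?_
    · exact continuous_iff_continuousAt.2 fun y =>
        EReal.Tendsto.const_mul Filter.tendsto_id (.inl (EReal.coe_ne_bot _))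
          (.inl (EReal.coe_ne_top _))
    · intro y z hyz
      exact mul_le_mul_of_nonneg_left hyz (by exact_mod_cast hn'.le)

/-- Near a point `p` of the domain, `φ` is bounded below by semicontinuity and compactness; along
rays from `p` convexity then forces at most linear decrease. -/
lemma exists_linear_minorant (hφ : IsConvexRegularizer φ) {p : Param d} {a : ℝ} (hp : φ p = a) :
    ∃ m c : ℝ, 0 ≤ c ∧ ∀ x, ((m - c * ‖x - p‖ : ℝ) : EReal) ≤ φ x := by
  obtain ⟨u, -, hu⟩ := LowerSemicontinuousOn.exists_isMinOn
    ⟨p, Metric.mem_closedBall_self zero_le_one⟩ (isCompact_closedBall p 1)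
    (hφ.lsc.lowerSemicontinuousOn _)
  have hup : φ u ≤ a := hp ▸ hu (Metric.mem_closedBall_self zero_le_one)
  obtain ⟨m, hm⟩ : ∃ m : ℝ, φ u = m := by
    induction h : φ u with
    | bot => exact absurd h (hφ.ne_bot u)
    | top => rw [h] at hup; simp at hup
    | coe m => exact ⟨m, rfl⟩
  rw [hm, EReal.coe_le_coe_iff] at hup
  refine ⟨m, a - m, sub_nonneg.2 hup, fun x => ?_⟩
  rcases le_or_gt ‖x - p‖ 1 with hx | hx
  · have : φ u ≤ φ x := hu (by simpa [dist_eq_norm] using hx)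
    refine le_trans ?_ (hm ▸ this)
    rw [EReal.coe_le_coe_iff]
    have := mul_nonneg (sub_nonneg.2 hup) (norm_nonneg (x - p))
    linarith
  · induction h : φ x with
    | bot => exact absurd h (hφ.ne_bot x)
    | top => exact le_top
    | coe b =>
      have h0 : 0 < ‖x - p‖ := one_pos.trans hx
      have h1 := hφ.convexCombo_le hp.le h.le (inv_nonneg.2 h0.le) (inv_le_one_of_one_le₀ hx.le)
      have h2 : φ u ≤ φ (p + ‖x - p‖⁻¹ • (x - p)) := hu (by
        simp [norm_smul, h0.ne'])
      have h3 := h2.trans h1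
      rw [hm, EReal.coe_le_coe_iff] at h3
      rw [EReal.coe_le_coe_iff]
      have h4 : ‖x - p‖ * m ≤ ‖x - p‖ * a + (b - a) := by
        have := mul_le_mul_of_nonneg_left h3 h0.le
        rwa [mul_add, mul_inv_cancel_left₀ h0.ne'] at this
      linarith

/-- The quadratic term beats the linear lower bound on `φ`, so the minimum over a large closed ball
is a global minimum. -/
lemma exists_isMinOn_add_sq (hφ : IsConvexRegularizer φ) {η : ℝ} (hη : 0 < η) (z : Param d) :
    ∃ x, IsMinOn (fun x => φ x + ((‖x - z‖ ^ 2 / (2 * η) : ℝ) : EReal)) Set.univ x := by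
  obtain ⟨p, hp⟩ := hφ.proper
  obtain ⟨a, ha⟩ : ∃ a : ℝ, φ p = a := by
    induction h : φ p with
    | bot => exact absurd h (hφ.ne_bot p)
    | top => exact absurd h hp
    | coe a => exact ⟨a, rfl⟩
  obtain ⟨m, c, hc, hmin⟩ := hφ.exists_linear_minorant ha
  have hlsc : LowerSemicontinuous fun x => φ x + ((‖x - z‖ ^ 2 / (2 * η) : ℝ) : EReal) := by
    refine hφ.lsc.add' ?_ fun x => ?_
    · exact (continuous_coe_real_ereal.comp (by fun_prop)).lowerSemicontinuous
    · exact EReal.continuousAt_add (.inr (EReal.coe_ne_bot _)) (.inl (hφ.ne_bot x))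
  -- Far from `p` the objective is at least its value at `p`.
  have hfar : ∃ R, 0 ≤ R ∧ ∀ x, R < ‖x - p‖ →
      a + ‖p - z‖ ^ 2 / (2 * η) ≤ m - c * ‖x - p‖ + ‖x - z‖ ^ 2 / (2 * η) := by
    set e := ‖p - z‖ with he
    have he0 : 0 ≤ e := norm_nonneg _
    set b := |a + e ^ 2 / (2 * η) - m + c * e| with hb
    refine ⟨e + (1 + 2 * η * (c + b)), by positivity, fun x hx => ?_⟩
    have htri : ‖x - p‖ ≤ ‖x - z‖ + e := by
      rw [he, norm_sub_rev p z]; exact norm_sub_le_norm_sub_add_norm_sub x z p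
    set y := ‖x - z‖ with hy
    have hb0 : 0 ≤ b := abs_nonneg _
    have hyge : 1 + 2 * η * (c + b) ≤ y := by linarith
    have hy1 : 1 ≤ y := le_trans (by have : 0 ≤ 2 * η * (c + b) := by positivity
                                     linarith) hyge
    have h1 : c * y + b ≤ y ^ 2 / (2 * η) := by
      rw [le_div_iff₀ (by positivity)]
      nlinarith [mul_nonneg hη.le (mul_nonneg hb0 (sub_nonneg.2 hy1))]
    have h2 := le_abs_self (a + e ^ 2 / (2 * η) - m + c * e)
    have h3 := mul_le_mul_of_nonneg_left htri hc
    linarith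
  obtain ⟨R, hR, hfar⟩ := hfar
  obtain ⟨u, -, hu⟩ := LowerSemicontinuousOn.exists_isMinOn
    ⟨p, Metric.mem_closedBall_self hR⟩ (isCompact_closedBall p R) (hlsc.lowerSemicontinuousOn _)
  refine ⟨u, fun x _ => ?_⟩
  rcases le_or_gt ‖x - p‖ R with hx | hx
  · exact hu (by simpa [dist_eq_norm] using hx)
  · refine le_trans (isMinOn_iff.1 hu p (Metric.mem_closedBall_self hR)) ?_
    simp only [ha]
    rw [← EReal.coe_add]
    refine (EReal.coe_le_coe_iff.2 (hfar x hx)).trans ?_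
    rw [EReal.coe_add]
    gcongr
    exact hmin x

lemma exists_coe_of_isMinOn (hφ : IsConvexRegularizer φ) {η : ℝ} {z u : Param d}
    (hu : IsMinOn (fun x => φ x + ((‖x - z‖ ^ 2 / (2 * η) : ℝ) : EReal)) Set.univ u) :
    ∃ a : ℝ, φ u = a := by
  obtain ⟨p, hp⟩ := hφ.proper
  induction h : φ u with
  | bot => exact absurd h (hφ.ne_bot u)
  | coe a => exact ⟨a, rfl⟩
  | top =>
    have := hu (Set.mem_univ p)
    simp only [Set.mem_ofPred_eq, h, EReal.top_add_coe, top_le_iff] at this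
    exact absurd this (EReal.add_ne_top hp (EReal.coe_ne_top _))

open scoped RealInnerProductSpace in
/-- First-order optimality of a minimizer `u`: compare the objective at `u` and at `u + t (v - u)`,
divide by `t` and let `t → 0`. -/
lemma sub_le_inner_of_isMinOn (hφ : IsConvexRegularizer φ) {η : ℝ} (hη : 0 < η) {z u v : Param d}
    (hu : IsMinOn (fun x => φ x + ((‖x - z‖ ^ 2 / (2 * η) : ℝ) : EReal)) Set.univ u)
    {a b : ℝ} (ha : φ u = a) (hb : φ v = b) : η * (a - b) ≤ ⟪u - z, v - u⟫ := by
  have key : ∀ t : ℝ, 0 < t → t ≤ 1 →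
      η * (a - b) ≤ ⟪u - z, v - u⟫ + t * (‖v - u‖ ^ 2 / 2) := by
    intro t ht ht1
    have h1 := hu (Set.mem_univ (u + t • (v - u)))
    have h2 := hφ.convexCombo_le ha.le hb.le ht.le ht1
    simp only [Set.mem_ofPred_eq, ha] at h1
    have h3 := h1.trans (add_le_add_left h2 _)
    rw [← EReal.coe_add, ← EReal.coe_add, EReal.coe_le_coe_iff] at h3
    have h4 : ‖u + t • (v - u) - z‖ ^ 2
        = ‖u - z‖ ^ 2 + 2 * t * ⟪u - z, v - u⟫ + t ^ 2 * ‖v - u‖ ^ 2 := by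
      rw [show u + t • (v - u) - z = (u - z) + t • (v - u) by abel, norm_add_sq_real,
        real_inner_smul_right, norm_smul, mul_pow, Real.norm_eq_abs, sq_abs]
      ring
    rw [h4] at h3
    have h5 : t * (η * (a - b)) ≤ t * (⟪u - z, v - u⟫ + t * (‖v - u‖ ^ 2 / 2)) := by
      have h6 := mul_le_mul_of_nonneg_left h3 hη.le
      have h7 : ∀ r, η * (r / (2 * η)) = r / 2 := fun r => by field_simp
      simp only [mul_add, h7] at h6
      linarith
    exact le_of_mul_le_mul_left h5 ht
  refine le_of_forall_pos_le_add fun ε hε => ?_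
  have hpos : 0 < ‖v - u‖ ^ 2 / 2 + 1 := by positivity
  refine (key (min 1 (ε / (‖v - u‖ ^ 2 / 2 + 1))) (by positivity) (min_le_left _ _)).trans ?_
  gcongr
  calc _ ≤ ε / (‖v - u‖ ^ 2 / 2 + 1) * (‖v - u‖ ^ 2 / 2 + 1) := by
        gcongr
        · exact min_le_right _ _
        · linarith
    _ = ε := div_mul_cancel₀ _ hpos.ne'

open scoped RealInnerProductSpace in
/-- Adding the optimality conditions of the two minimizers, each tested at the other one, gives
`‖u - v‖² ≤ ⟪z - w, u - v⟫`. -/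
lemma norm_sub_le_of_isMinOn (hφ : IsConvexRegularizer φ) {η : ℝ} (hη : 0 < η)
    {z w u v : Param d}
    (hu : IsMinOn (fun x => φ x + ((‖x - z‖ ^ 2 / (2 * η) : ℝ) : EReal)) Set.univ u)
    (hv : IsMinOn (fun x => φ x + ((‖x - w‖ ^ 2 / (2 * η) : ℝ) : EReal)) Set.univ v) :
    ‖u - v‖ ≤ ‖z - w‖ := by
  obtain ⟨a, ha⟩ := hφ.exists_coe_of_isMinOn hu
  obtain ⟨b, hb⟩ := hφ.exists_coe_of_isMinOn hv
  have h1 := hφ.sub_le_inner_of_isMinOn hη hu ha hb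
  have h2 := hφ.sub_le_inner_of_isMinOn hη hv hb ha
  have h3 : ⟪u - z, v - u⟫ + ⟪v - w, u - v⟫ = ⟪z - w, u - v⟫ - ‖u - v‖ ^ 2 := by
    rw [← real_inner_self_eq_norm_sq]
    simp only [inner_sub_left, inner_sub_right]
    ring
  have h4 := real_inner_le_norm (z - w) (u - v)
  have h5 : ‖u - v‖ * ‖u - v‖ ≤ ‖z - w‖ * ‖u - v‖ := by nlinarith
  rcases (norm_nonneg (u - v)).eq_or_lt with h | h
  · rw [← h]; exact norm_nonneg _
  · exact le_of_mul_le_mul_right h5 h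

end IsConvexRegularizer

/-- In particular the regularization step is measurable, so that pushing a law forward along it
loses no mass. -/
lemma lipschitzWith_proxStep {d : ℕ} {ψ : Param d → EReal} (hψ : IsConvexRegularizer ψ) (n : ℕ)
    {η : ℝ} (hη : 0 < η) : LipschitzWith 1 (proxStep n ψ η) := by
  have hmin : ∀ z, IsMinOn (proxObjective n ψ η z) Set.univ (proxStep n ψ η z) := fun z =>
    Classical.epsilon_spec ((hψ.nat_mul n).exists_isMinOn_add_sq hη z)
  refine LipschitzWith.of_dist_le_mul fun z w => ?_
  rw [dist_eq_norm, dist_eq_norm, NNReal.coe_one, one_mul]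
  exact (hψ.nat_mul n).norm_sub_le_of_isMinOn hη (hmin z) (hmin w)

/-! ### The iterates have probability laws -/

lemma measurable_gradient {d : ℕ} (h : Param d → ℝ) : Measurable (gradient h) :=
  (InnerProductSpace.toDual ℝ (Param d)).symm.continuous.measurable.comp (measurable_fderiv ℝ h)

lemma measurable_noisyGradStep {d : ℕ} (η : ℝ) (h : Param d → ℝ) :
    Measurable fun p : Param d × Param d => p.1 - η • (gradient h p.1 + p.2) :=
  measurable_fst.sub
    ((((measurable_gradient h).comp measurable_fst).add measurable_snd).const_smul η)

instance isProbabilityMeasure_noisyGradLaw {d : ℕ} (η σ : ℝ) (h : Param d → ℝ)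
    (μ : Measure (Param d)) [IsProbabilityMeasure μ] :
    IsProbabilityMeasure (noisyGradLaw η σ h μ) :=
  Measure.isProbabilityMeasure_map (measurable_noisyGradStep η h).aemeasurable

lemma isProbabilityMeasure_foldl {X ι : Type*} [MeasurableSpace X]
    {Φ : Measure X → ι → Measure X}
    (hΦ : ∀ i μ, IsProbabilityMeasure μ → IsProbabilityMeasure (Φ μ i)) (l : List ι) :
    ∀ μ, IsProbabilityMeasure μ → IsProbabilityMeasure (l.foldl Φ μ) := by
  induction l with
  | nil => exact fun μ h => h
  | cons i l ih => exact fun μ h => ih _ (hΦ i μ h)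

lemma isProbabilityMeasure_epochLaw {d n : ℕ} {Z : Type*} (f : Param d → Z → ℝ)
    {ψ : Param d → EReal} (hψ : IsConvexRegularizer ψ) {η : ℝ} (hη : 0 < η) (σ : ℝ)
    (D : Fin n → Z) (π : Equiv.Perm (Fin n)) (μ : Measure (Param d)) [IsProbabilityMeasure μ] :
    IsProbabilityMeasure (epochLaw f ψ η σ D π μ) := by
  have := isProbabilityMeasure_foldl (Φ := fun ν i => noisyGradLaw η σ (fun x => f x (D (π i))) ν)
    (fun i ν _ => inferInstance) (List.finRange n) μ inferInstance
  exact Measure.isProbabilityMeasure_map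
    (lipschitzWith_proxStep hψ n hη).continuous.measurable.aemeasurable

lemma isProbabilityMeasure_runLaw {d n : ℕ} {Z : Type*} (f : Param d → Z → ℝ)
    {ψ : Param d → EReal} (hψ : IsConvexRegularizer ψ) {η : ℝ} (hη : 0 < η) (σ : ℝ)
    (x₀ : Param d) (K : ℕ) (D : Fin n → Z) (π : Fin K → Equiv.Perm (Fin n)) :
    IsProbabilityMeasure (runLaw f ψ η σ x₀ K D π) :=
  isProbabilityMeasure_foldl (fun s μ _ => isProbabilityMeasure_epochLaw f hψ hη σ D (π s) μ) _ _
    inferInstance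

lemma isProbabilityMeasure_dpShuffleG {d n : ℕ} {Z : Type*} (scheme : ShuffleScheme n)
    (f : Param d → Z → ℝ) {ψ : Param d → EReal} (hψ : IsConvexRegularizer ψ) {η : ℝ} (hη : 0 < η)
    (σ : ℝ) (x₀ : Param d) (K : ℕ) (D : Fin n → Z) :
    IsProbabilityMeasure (dpShuffleG scheme f ψ η σ x₀ K D) := by
  have := fun π => isProbabilityMeasure_runLaw f hψ hη σ x₀ K D π
  constructor
  have hw := (scheme.orderLaw K).tsum_coe
  rw [tsum_fintype] at hw
  simp [dpShuffleG, Measure.finsetSum_apply, hw]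

/-! ### Privacy loss along the iterations -/

/-- Iterated composition: the losses `C i` of the successive steps multiply. -/
lemma MomentDominated.foldl {X ι : Type*} [MeasurableSpace X] {q : ℝ}
    {Φ Ψ : Measure X → ι → Measure X} {C : ι → ℝ≥0∞}
    (h : ∀ i A μ ν, MomentDominated q A μ ν → MomentDominated q (A * C i) (Φ μ i) (Ψ ν i))
    (l : List ι) : ∀ A μ ν, MomentDominated q A μ ν →
      MomentDominated q (A * (l.map C).prod) (l.foldl Φ μ) (l.foldl Ψ ν) := by
  induction l with
  | nil => intro A μ ν hμν; simpa using hμν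
  | cons i l ih =>
    intro A μ ν hμν
    simpa [mul_assoc] using ih _ _ _ (h i A μ ν hμν)

/-- A noisy gradient step on two losses whose gradients differ by at most `c` costs at most the
loss of a Gaussian translate by `c`: conditionally on the current point, the two outcomes differ by a
translation of the noise. -/
lemma MomentDominated.noisyGradLaw {α q : ℝ} (hq : α.HolderConjugate q) {d : ℕ} (η : ℝ) {σ : ℝ}
    (hσ : 0 < σ) {h h' : Param d → ℝ} {c : ℝ} (hc : ∀ x, ‖gradient h x - gradient h' x‖ ≤ c)
    {A : ℝ≥0∞} {μ ν : Measure (Param d)} (hμν : MomentDominated q A μ ν) :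
    MomentDominated q (A * ENNReal.ofReal (Real.exp ((α - 1) * c ^ 2 / (2 * σ ^ 2))))
      (noisyGradLaw η σ h μ) (noisyGradLaw η σ h' ν) := by
  intro g hg
  have hg₁ : Measurable fun p : Param d × Param d => g (p.1 - η • (gradient h p.1 + p.2)) :=
    hg.comp (measurable_noisyGradStep η h)
  have hg' : Measurable fun p : Param d × Param d => g (p.1 - η • (gradient h' p.1 + p.2)) :=
    hg.comp (measurable_noisyGradStep η h')
  unfold _root_.noisyGradLaw
  rw [lintegral_map hg (measurable_noisyGradStep η h),
    lintegral_map (hg.pow_const q) (measurable_noisyGradStep η h'),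
    lintegral_prod _ hg₁.aemeasurable,
    lintegral_prod _ (hg'.pow_const q).aemeasurable]
  refine hμν.lintegral_le hq.symm.pos (hg'.pow_const q).lintegral_prod_right' fun x => ?_
  have hshift := (MomentDominated.noiseLaw_shift hq hσ (gradient h x - gradient h' x)) _
    (hg'.comp (measurable_prodMk_left (x := x)))
  rw [lintegral_map (hg'.comp measurable_prodMk_left) (by fun_prop)] at hshift
  refine le_trans (le_of_eq ?_) (hshift.trans ?_)
  · refine lintegral_congr fun ρ => ?_
    simp only [Function.comp_apply]
    congr 3
    abel
  · refine mul_le_mul' (ENNReal.ofReal_le_ofReal (Real.exp_le_exp.2 ?_)) le_rfl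
    have := hq.lt
    gcongr
    exact hc x

/-- An epoch visits the index at which the datasets differ exactly once, and only that step costs
anything; there the two gradients are at distance at most `2 * G`. -/
lemma MomentDominated.epochLaw {α q : ℝ} (hq : α.HolderConjugate q) {d n : ℕ} {Z : Type*}
    {f : Param d → Z → ℝ} {G : ℝ} (hlip : ∀ z, IsLipschitzLoss G (fun x => f x z))
    {ψ : Param d → EReal} (hψ : IsConvexRegularizer ψ) {η σ : ℝ} (hη : 0 < η) (hσ : 0 < σ)
    {D D' : Fin n → Z} (hD : AdjacentDatasets D D') (π : Equiv.Perm (Fin n))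
    {A : ℝ≥0∞} {μ ν : Measure (Param d)} (hμν : MomentDominated q A μ ν) :
    MomentDominated q (A * ENNReal.ofReal (Real.exp ((α - 1) * (2 * G) ^ 2 / (2 * σ ^ 2))))
      (epochLaw f ψ η σ D π μ) (epochLaw f ψ η σ D' π ν) := by
  obtain ⟨t, ht⟩ := hD
  set B := ENNReal.ofReal (Real.exp ((α - 1) * (2 * G) ^ 2 / (2 * σ ^ 2)))
  have hprod : ((List.finRange n).map fun i => if i = π.symm t then B else 1).prod = B := by
    rw [← Fin.prod_univ_def, Finset.prod_ite_eq' Finset.univ]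
    simp
  rw [← hprod]
  refine (MomentDominated.foldl (fun i A μ ν h => ?_) (List.finRange n) _ _ _ hμν).map
    (lipschitzWith_proxStep hψ n hη).continuous.measurable
  split_ifs with hi
  · refine h.noisyGradLaw hq η hσ fun x => (norm_sub_le _ _).trans ?_
    have h1 := (hlip (D (π i))).2 x
    have h2 := (hlip (D' (π i))).2 x
    linarith
  · have hi' : π i ≠ t := fun h => hi (by rw [← h, Equiv.symm_apply_apply])
    rw [ht _ hi']
    simpa using h.noisyGradLaw hq η hσ (c := 0) (h := fun x => f x (D' (π i))) (fun x => by simp)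

lemma MomentDominated.runLaw {α q : ℝ} (hq : α.HolderConjugate q) {d n : ℕ} {Z : Type*}
    {f : Param d → Z → ℝ} {G : ℝ} (hlip : ∀ z, IsLipschitzLoss G (fun x => f x z))
    {ψ : Param d → EReal} (hψ : IsConvexRegularizer ψ) {η σ : ℝ} (hη : 0 < η) (hσ : 0 < σ)
    (x₀ : Param d) (K : ℕ) {D D' : Fin n → Z} (hD : AdjacentDatasets D D')
    (π : Fin K → Equiv.Perm (Fin n)) :
    MomentDominated q
      (ENNReal.ofReal (Real.exp ((α - 1) / α * (2 * α * G ^ 2 * K / σ ^ 2))))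
      (runLaw f ψ η σ x₀ K D π) (runLaw f ψ η σ x₀ K D' π) := by
  have h := MomentDominated.foldl
    (fun s A μ ν h => h.epochLaw hq hlip hψ hη hσ hD (π s)) (List.finRange K) 1 _ _
    (MomentDominated.refl hq.symm.lt (Measure.dirac x₀))
  refine h.mono (le_of_eq ?_)
  rw [List.map_const', List.prod_replicate, List.length_finRange, one_mul,
    ← ENNReal.ofReal_pow (Real.exp_pos _).le, ← Real.exp_nat_mul]
  congr 2
  have := hq.pos.ne'
  field_simp

theorem lemma1 {d n K : ℕ} {Z : Type*} (scheme : ShuffleScheme n)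
    (f : Param d → Z → ℝ) (ψ : Param d → EReal) (x₀ : Param d) (L G η σ : ℝ)
    (hψ : IsConvexRegularizer ψ)
    (hL : 0 ≤ L)
    (hsmooth : ∀ z, IsSmoothLoss L (fun x => f x z))
    (hlip : ∀ z, IsLipschitzLoss G (fun x => f x z))
    (hη : 0 < η) (hηL : η * L ≤ 1) (hσ : 0 < σ)
    (α : ℝ) (hα : 1 < α) (δ : ℝ) (hδ₀ : 0 < δ) (hδ₁ : δ < 1) :
    IsDifferentiallyPrivate (dpShuffleG scheme f ψ η σ x₀ K)
      (2 * α * G ^ 2 * K / σ ^ 2 + Real.log (1 / δ) / (α - 1)) δ := by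
  have hprob := isProbabilityMeasure_dpShuffleG scheme f hψ hη σ x₀ K
  refine ⟨hprob, fun D D' hD S hS => ?_⟩
  have hq := Real.HolderConjugate.conjExponent hα
  have hw := (scheme.orderLaw K).tsum_coe
  rw [tsum_fintype] at hw
  have : IsProbabilityMeasure (∑ π, scheme.orderLaw K π • runLaw f ψ η σ x₀ K D' π) := hprob D'
  exact (MomentDominated.sum hq.symm.lt hw fun π =>
    MomentDominated.runLaw hq hlip hψ hη hσ x₀ K hD π).measure_le hα hq hδ₀ rfl hS
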